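/- \textbf{Setting.} Time is discrete. A mixed-criticality sporadic task set $\tau=\{\tau_1,\dots,\tau_n\}$, indexed by decreasing priority, runs on $m\ge 1$ identical processors. Task $\tau_i$ has a minimum inter-arrival time $T_i$, a relative deadline $1\le D_i\le T_i$, a criticality $L_i\ge 1$ and execution-time bounds $C_i(\ell)\ge 1$ ($\ell\ge1$), non-decreasing in $\ell$ up to $L_i$ and constant from $L_i$ on. Every job of $\tau_i$ needs at most $C_i(L_i)$ units of execution. The jobs of one task are executed one after the other. The scheduler is global, preemptive, work-conserving and static-priority: in each unit slot the $m$ highest-priority available jobs of enabled tasks execute. When the criticality level in force is $g$, exactly the tasks with $L_i\ge g$ are enabled; the jobs of a task that gets suspended are dropped (they may at most use left-over processors). Write $\tau^h=\{\tau_i : L_i\ge h\}$ and let $\mathtt{hp}(\tau_i)$ be the set of tasks of higher priority than $\tau_i$. \textbf{Response times.} For $1\le\ell\le L_i$, $R_i(\ell)$ is the least fixed point of $x=C_i(\ell)+\lfloor \bar I_i(x,\ell)/m\rfloor$, where $\bar I_i(x,\ell)$ is the sum of $I^{NC}_{j,i}(x,\ell)$ over $\tau_j\in\mathtt{hp}(\tau_i)$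 plus the sum of the $m-1$ largest values $I^{CI}_{j,i}(x,\ell)-I^{NC}_{j,i}(x,\ell)$. Here $I^{NC}_{j,i}(x,\ell)$ (resp. $I^{CI}_{j,i}(x,\ell)$) is the minimum of $\max(0,\,x-C_i(\ell)+1)$ and of the maximal workload of $\tau_j$ in a window of length $x$ (of length $\min(x,R_i(L_j))$ if $L_j<\ell$), taken over all patterns whose releases are at least $T_j$ apart and in which each job executes for at most $C_j(\ell)$ and only within $R_j(\min(\ell,L_j))$ of its release, when no job (resp. when possibly a job) released before the window executes in it. The task set is assumed to be deemed schedulable: $R_i(\ell)\le D_i$ for all $i$ and all $1\le\ell\le L_i$. \textbf{Requests.} $\mathtt{IMCR}_{g+1}$ is triggered at time $t$ if at $t$ a job, not dropped, of a task of criticality greater than $g$ has just executed for its $C_i(g)$ without completing. \textbf{Protocol.} Let $1\le\ell<h$ and $\tau^h\ne\emptyset$. The system has been running in mode $M_h$ (level $h$, no jobs of suspended tasks being executed) since a time $t_h$, and a $\mathtt{DMCR}_\ell$ is issued at a time $t_D>t_h$; the history before $t_h$ is arbitrary. For the tasks $\tau_{h_1},\tau_{h_2},\dots,\tau_{n_h}$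 of $\tau^h$ in priority order, the protocol determines successively the first time $f_{h_i}$, at or after $t_D$ and at or after the times found before, at which a job of $\tau_{h_i}$ completes within $R_{h_i}(\ell)$ of its release. Let $f^*$ be the time found for the last task $\tau_{n_h}$. Suppose that the system stays in $M_h$ during $[t_D,f^*)$, that no $\mathtt{IMCR}_{\ell+1}$ is triggered in $[t_D,f^*)$, and that at $f^*$ all suspended tasks of mode $M_\ell$ (those with $\ell\le L_i<h$) are re-enabled by setting the level to $\ell$, after which the level changes only by increasing mode change requests: at $f^*$ and at each later time it is raised to the least level $g$, not below its current value, for which no $\mathtt{IMCR}_{g+1}$ is triggered at that time. \textbf{Theorem.} It is then safe to re-enable the suspended tasks of $M_\ell$ at time $f^*$, that is: \begin{enumerate} \item ($h$-periodicity) from $f^*$ on, every task $\tau_i\in\tau^h$ is enabled and each of its activations releases a job, whenever the level does not exceed $L_i$; \item ($h$-feasibility) every job of a task $\tau_i\in\tau^h$ that is available at $f^*$ or released at or after $f^*$ meets its deadline, provided that the level does not exceed $L_i$ between its release and its deadline (increasing mode change requests may occur after $f^*$); \item every job released at or after $f^*$ by a re-enabled task $\tau_k$ ($\ell\le L_k<h$)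 meets its deadline, provided that no $\mathtt{IMCR}_{\ell+1}$ is triggered from $f^*$ until that deadline. \end{enumerate} -/

import Mathlib

/-! Time is discrete: `t : ℕ` is both an instant and the unit slot `[t, t + 1)`. -/

/-- A mixed-criticality sporadic task set with `n` tasks. The index of a task is its priority:
`i < j` means that task `i` has a higher priority than task `j`. -/
structure TaskSet (n : ℕ) where
  /-- minimum inter-arrival time -/
  T : Fin n → ℕ
  /-- relative deadline -/
  D : Fin n → ℕ
  /-- criticality of the task -/
  L : Fin n → ℕ
  /-- `C i ℓ` is the worst-case execution time of task `i` at criticality level `ℓ ≥ 1` -/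
  C : Fin n → ℕ → ℕ
  D_pos : ∀ i, 0 < D i
  D_le_T : ∀ i, D i ≤ T i
  L_pos : ∀ i, 0 < L i
  C_pos : ∀ i ℓ, 1 ≤ ℓ → 0 < C i ℓ
  C_mono : ∀ i ℓ, 1 ≤ ℓ → ℓ < L i → C i ℓ ≤ C i (ℓ + 1)
  C_const : ∀ i ℓ, L i ≤ ℓ → C i ℓ = C i (L i)

/-! ### Workload, interfering workload and worst-case response times -/

/-- An admissible execution pattern of one sporadic task: `rel` is the set of release times of its
jobs, and the job released at `r` executes in the slots `slots r`. Releases are at least `T`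
apart, each job executes for at most `C` slots, and only within `R` time units of its release. -/
structure IsPattern (T C R : ℕ) (rel : Set ℕ) (slots : ℕ → Finset ℕ) : Prop where
  sep : ∀ r ∈ rel, ∀ r' ∈ rel, r < r' → r + T ≤ r'
  within : ∀ r ∈ rel, ∀ t ∈ slots r, r ≤ t ∧ t < r + R
  budget : ∀ r ∈ rel, (slots r).card ≤ C

/-- The workload of the pattern in the window `[a, a + Δ)`: the number of slots of the window in
which a job of the task executes. -/
noncomputable def workload (rel : Set ℕ) (slots : ℕ → Finset ℕ) (a Δ : ℕ) : ℕ :=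
  {t | a ≤ t ∧ t < a + Δ ∧ ∃ r ∈ rel, t ∈ slots r}.ncard

/-- The pattern is carry-in for the window `[a, a + Δ)`: some job released before the window
executes within it. -/
def CarryIn (rel : Set ℕ) (slots : ℕ → Finset ℕ) (a Δ : ℕ) : Prop :=
  ∃ r ∈ rel, r < a ∧ ∃ t ∈ slots r, a ≤ t ∧ t < a + Δ

/-- Maximal workload in a window of length `Δ` of a task that is not carry-in. -/
noncomputable def maxWorkloadNC (T C R Δ : ℕ) : ℕ :=
  sSup {w | ∃ rel slots a, IsPattern T C R rel slots ∧ ¬ CarryIn rel slots a Δ ∧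
    w = workload rel slots a Δ}

/-- Maximal workload in a window of length `Δ` of a task that may be carry-in. -/
noncomputable def maxWorkloadCI (T C R Δ : ℕ) : ℕ :=
  sSup {w | ∃ rel slots a, IsPattern T C R rel slots ∧ w = workload rel slots a Δ}

/-- The workload in a window of length `Δ` is at most `Δ`, so the suprema above are maxima. -/
theorem workload_le (rel : Set ℕ) (slots : ℕ → Finset ℕ) (a Δ : ℕ) :
    workload rel slots a Δ ≤ Δ := by
  have h : {t | a ≤ t ∧ t < a + Δ ∧ ∃ r ∈ rel, t ∈ slots r} ⊆ ↑(Finset.Ico a (a + Δ)) := by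
    intro t ht
    simp only [Finset.coe_Ico, Set.mem_Ico]
    exact ⟨ht.1, ht.2.1⟩
  have h2 := Set.ncard_le_ncard h (Finset.finite_toSet _)
  rw [Set.ncard_coe_finset, Nat.card_Ico] at h2
  unfold workload
  omega

theorem maxWorkloadNC_le_CI (T C R Δ : ℕ) : maxWorkloadNC T C R Δ ≤ maxWorkloadCI T C R Δ := by
  refine csSup_le_csSup ⟨Δ, ?_⟩ ⟨0, ∅, fun _ => ∅, 0, ⟨by simp, by simp, by simp⟩, ?_, ?_⟩ ?_
  · rintro w ⟨rel, slots, a, -, rfl⟩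
    exact workload_le rel slots a Δ
  · rintro ⟨r, hr, -⟩
    exact hr
  · simp [workload]
  · rintro w ⟨rel, slots, a, hp, -, hw⟩
    exact ⟨rel, slots, a, hp, hw⟩

namespace TaskSet

variable {n : ℕ}

/-- The part of a window of length `Δ` of task `i`, in a scenario of criticality level `ℓ`, in which
task `j` may interfere. A task of criticality `L j < ℓ` is suspended as soon as level `L j` is
exceeded, which happens at most `R i (L j)` after the start of the window if the job of task `i`
has not completed by then. -/
def interfWindow (τ : TaskSet n) (R : Fin n → ℕ → ℕ) (j i : Fin n) (Δ ℓ : ℕ) : ℕ :=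
  if τ.L j < ℓ then min Δ (R i (τ.L j)) else Δ

/-- Non carry-in interfering workload of task `j` on task `i`. The jobs of task `j` execute for at
most `C j ℓ` and respond within `R j (min ℓ (L j))`. Only the slots in which the job of task `i` is
not dispatched count; in a window of length `Δ` at whose end that job has not yet executed for
`C i ℓ`, there are at least `Δ - C i ℓ + 1` such slots, and it is enough to charge this many. -/
noncomputable def interfNC (τ : TaskSet n) (R : Fin n → ℕ → ℕ) (j i : Fin n) (Δ ℓ : ℕ) : ℕ :=
  min (maxWorkloadNC (τ.T j) (τ.C j ℓ) (R j (min ℓ (τ.L j))) (τ.interfWindow R j i Δ ℓ))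
    (Δ + 1 - τ.C i ℓ)

/-- Carry-in interfering workload of task `j` on task `i`. -/
noncomputable def interfCI (τ : TaskSet n) (R : Fin n → ℕ → ℕ) (j i : Fin n) (Δ ℓ : ℕ) : ℕ :=
  min (maxWorkloadCI (τ.T j) (τ.C j ℓ) (R j (min ℓ (τ.L j))) (τ.interfWindow R j i Δ ℓ))
    (Δ + 1 - τ.C i ℓ)

/-- `I^DIFF = I^CI - I^NC`; the difference is never negative, see `maxWorkloadNC_le_CI`. -/
noncomputable def interfDiff (τ : TaskSet n) (R : Fin n → ℕ → ℕ) (j i : Fin n) (Δ ℓ : ℕ) : ℕ :=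
  τ.interfCI R j i Δ ℓ - τ.interfNC R j i Δ ℓ

/-- Total interfering workload on task `i` on `m` processors: the non carry-in interfering
workloads of all tasks of higher priority, plus the sum of the `m - 1` largest `I^DIFF`. -/
noncomputable def totalInterf (τ : TaskSet n) (m : ℕ) (R : Fin n → ℕ → ℕ) (i : Fin n)
    (Δ ℓ : ℕ) : ℕ :=
  ∑ j ∈ Finset.Iio i, τ.interfNC R j i Δ ℓ +
    ((Finset.Iio i).powerset.filter (fun S => S.card ≤ m - 1)).sup
      (fun S => ∑ j ∈ S, τ.interfDiff R j i Δ ℓ)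

/-- `R` is the table of the computed worst-case response times: `R i ℓ` is, for `1 ≤ ℓ ≤ L i`, the
least fixed point of `x = C i ℓ + ⌊I_i(x, ℓ) / m⌋`. On the right-hand side the table is only used at
the tasks of higher priority, and at task `i` for levels below `ℓ`, so that `R` is determined
uniquely on its range of interest. -/
def IsWCRT (τ : TaskSet n) (m : ℕ) (R : Fin n → ℕ → ℕ) : Prop :=
  ∀ i ℓ, 1 ≤ ℓ → ℓ ≤ τ.L i →
    IsLeast {x | x = τ.C i ℓ + τ.totalInterf m R i x ℓ / m} (R i ℓ)

/-- The task set passes the schedulability test of the scheduler with its given priorities. -/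
def Schedulable (τ : TaskSet n) (R : Fin n → ℕ → ℕ) : Prop :=
  ∀ i ℓ, 1 ≤ ℓ → ℓ ≤ τ.L i → R i ℓ ≤ τ.D i

end TaskSet

/-! ### Runs of the system -/

/-- A run of the system. A job of task `i` is identified with its release time `r`. -/
structure Run (n : ℕ) where
  /-- activation times of the tasks -/
  act : Fin n → Set ℕ
  /-- exact execution time of the job of task `i` released at `r` -/
  cost : Fin n → ℕ → ℕ
  /-- criticality level (operating mode) in force in slot `t` -/
  level : ℕ → ℕ
  /-- the job of task `i` released at `r` executes in slot `t` -/
  runs : Fin n → ℕ → ℕ → Prop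

namespace Run

variable {n : ℕ}

/-- Task `i` is enabled at `t`: it belongs to the mode in force. -/
def Enabled (X : Run n) (τ : TaskSet n) (i : Fin n) (t : ℕ) : Prop := X.level t ≤ τ.L i

/-- Task `i` releases a job at `r`: it is activated at `r` and not suspended. -/
def Released (X : Run n) (τ : TaskSet n) (i : Fin n) (r : ℕ) : Prop :=
  r ∈ X.act i ∧ X.Enabled τ i r

open Classical in
/-- Execution time received before instant `t` by the job of task `i` released at `r`. -/
noncomputable def executed (X : Run n) (i : Fin n) (r t : ℕ) : ℕ := Nat.count (X.runs i r) t

/-- The job was released by time `t` and has not been dropped: its task has been enabled ever since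
the release. -/
def InMode (X : Run n) (τ : TaskSet n) (i : Fin n) (r t : ℕ) : Prop :=
  X.Released τ i r ∧ r ≤ t ∧ ∀ s, r ≤ s → s ≤ t → X.Enabled τ i s

/-- The job is available at `t` for being dispatched. -/
def Available (X : Run n) (τ : TaskSet n) (i : Fin n) (r t : ℕ) : Prop :=
  X.InMode τ i r t ∧ X.executed i r t < X.cost i r

/-- The job is the earliest available job of its task; the jobs of a task are executed one after
the other. -/
def Ready (X : Run n) (τ : TaskSet n) (i : Fin n) (r t : ℕ) : Prop :=
  X.Available τ i r t ∧ ∀ r', r' < r → ¬ X.Available τ i r' t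

/-- The general laws of a run: activations are sporadic, no job needs more than the worst-case
execution time of its task at the task's own criticality, and jobs execute between their release
and their completion only. -/
structure Legal (X : Run n) (τ : TaskSet n) : Prop where
  sporadic : ∀ i, ∀ r ∈ X.act i, ∀ r' ∈ X.act i, r < r' → r + τ.T i ≤ r'
  cost_pos : ∀ i, ∀ r ∈ X.act i, 0 < X.cost i r
  cost_le : ∀ i, ∀ r ∈ X.act i, X.cost i r ≤ τ.C i (τ.L i)
  runs_ok : ∀ i r t, X.runs i r t → X.Released τ i r ∧ r ≤ t ∧ X.executed i r t < X.cost i r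

/-- Slot `t` is scheduled by global preemptive work-conserving static-priority scheduling on `m`
identical processors: the ready jobs of the `m` highest priorities execute. Dropped jobs may be
discarded, or may use processors that are left over. -/
def ScheduledAt (X : Run n) (τ : TaskSet n) (m t : ℕ) : Prop :=
  (∀ i r, X.InMode τ i r t →
    (X.runs i r t ↔ X.Ready τ i r t ∧ {j | j < i ∧ ∃ r', X.Ready τ j r' t}.ncard < m)) ∧
  {p : Fin n × ℕ | X.runs p.1 p.2 t}.encard ≤ m

/-- The system is in operating mode `M_h` in slot `t`: exactly the tasks of criticality at least
`h` are enabled, and no job left over by a suspension is being executed. -/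
def InOperatingMode (X : Run n) (τ : TaskSet n) (h t : ℕ) : Prop :=
  X.level t = h ∧ ∀ i r, X.runs i r t → X.InMode τ i r t

/-- `IMCR_{ℓ+1}` is triggered at time `t`: a job of a task of criticality greater than `ℓ` has at
`t` just executed for its worst-case execution time of level `ℓ` without completing. -/
def IncreasingRequest (X : Run n) (τ : TaskSet n) (ℓ t : ℕ) : Prop :=
  ∃ s i r, t = s + 1 ∧ ℓ < τ.L i ∧ X.InMode τ i r s ∧ X.runs i r s ∧
    X.executed i r t = τ.C i ℓ ∧ τ.C i ℓ < X.cost i r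

/-- The job of task `i` released at `r` completes its execution at time `t`. -/
def CompletesAt (X : Run n) (i : Fin n) (r t : ℕ) : Prop :=
  ∃ s, t = s + 1 ∧ X.runs i r s ∧ X.executed i r t = X.cost i r

/-- The job of task `i` released at `r` meets its deadline. -/
def MeetsDeadline (X : Run n) (τ : TaskSet n) (i : Fin n) (r : ℕ) : Prop :=
  X.executed i r (r + τ.D i) = X.cost i r

/-- The search of the transition protocol in `M_h` for a `DMCR_ℓ` issued at `tD`: for each task `i`
of criticality at least `h`, in the order of priorities, `f i` is the first time, not before `tD`
and not before the times found for the tasks of higher priority, at which a job of task `i`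
completes within `R i ℓ` of its release. -/
def Identifies (X : Run n) (τ : TaskSet n) (R : Fin n → ℕ → ℕ) (h ℓ tD : ℕ)
    (f : Fin n → ℕ) : Prop :=
  ∀ i, h ≤ τ.L i →
    IsLeast {t | tD ≤ t ∧ (∀ j, j < i → h ≤ τ.L j → f j ≤ t) ∧
      ∃ r, X.CompletesAt i r t ∧ t ≤ r + R i ℓ} (f i)

/-- At time `u` the tasks of `M_ℓ` are all enabled, and from `u` on the level is only changed by
increasing mode change requests: at each instant it is raised as far as the requests that are
triggered at that instant demand. -/
def ReenablesAt (X : Run n) (τ : TaskSet n) (ℓ u : ℕ) : Prop :=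
  IsLeast {g | ℓ ≤ g ∧ ¬ X.IncreasingRequest τ g u} (X.level u) ∧
  ∀ t, u ≤ t →
    IsLeast {g | X.level t ≤ g ∧ ¬ X.IncreasingRequest τ g (t + 1)} (X.level (t + 1))

/-- From time `u` on, the activation pattern of the tasks of criticality at least `h` is respected,
as long as the level does not exceed the criticality of the task. -/
def PeriodicityFrom (X : Run n) (τ : TaskSet n) (h u : ℕ) : Prop :=
  ∀ i, h ≤ τ.L i → ∀ t, u ≤ t → X.level t ≤ τ.L i →
    X.Enabled τ i t ∧ (t ∈ X.act i → X.Released τ i t)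

/-- Every job of a task of criticality at least `h` that is available at time `u` or released from
`u` on meets its deadline, unless the level exceeds the criticality of the task before. -/
def FeasibilityFrom (X : Run n) (τ : TaskSet n) (h u : ℕ) : Prop :=
  ∀ i, h ≤ τ.L i → ∀ r, (X.Available τ i r u ∨ (u ≤ r ∧ X.Released τ i r)) →
    (∀ t, r ≤ t → t < r + τ.D i → X.level t ≤ τ.L i) → X.MeetsDeadline τ i r

/-- It is safe to re-enable the suspended tasks of `M_ℓ` at time `u`: `h`-periodicity and
`h`-feasibility are preserved, and each job that a re-enabled task releases from `u` on meets its
deadline if no `IMCR_{ℓ+1}` is triggered from `u` until then. -/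
def SafeReenabling (X : Run n) (τ : TaskSet n) (h ℓ u : ℕ) : Prop :=
  X.PeriodicityFrom τ h u ∧ X.FeasibilityFrom τ h u ∧
  ∀ i, ℓ ≤ τ.L i → τ.L i < h → ∀ r, u ≤ r → X.Released τ i r →
    (∀ t, u ≤ t → t < r + τ.D i → ¬ X.IncreasingRequest τ ℓ t) → X.MeetsDeadline τ i r

end Run

namespace TaskSet

variable {n : ℕ}

/-! Although mode `M_h` is in force up to `f*`, no request above `ℓ` occurs from `tD` on, so there
the run can be read as one of level `ℓ`. The virtual level is `ℓ` before `f*` and the actual level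
afterwards. It is monotone and bounds execution times from each task's settling time on: the time
found for a task of `τ^h`, and `f*` for the others. At that time fewer than `m` tasks of higher
priority are carry-in. From it on, the available jobs of each task of at least that priority were
released no earlier than that task's own settling time. `Identifies.settled` shows this.

In such a run the computed response times are valid (`Settled.responds`). The window of a job is
extended back to the end of the last uncontended slot, where fewer than `m` tasks are carry-in. If
the job were unfinished `x = R i g` after the window starts, `m` tasks of higher priority would
execute in `x + 1 - C i g` slots. Double counting bounds this work by the total interference,
against the fixed-point equation. Bounds for higher priorities, lower levels and earlier jobs of the
task enter by nested induction. Deadlines follow from `R ≤ D`. -/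

theorem C_le_C (τ : TaskSet n) (i : Fin n) {g g' : ℕ} (hg : 1 ≤ g) (hgg : g ≤ g') :
    τ.C i g ≤ τ.C i g' := by
  induction g', hgg using Nat.le_induction with
  | base => exact le_rfl
  | succ k hk ih =>
    refine ih.trans ?_
    rcases lt_or_ge k (τ.L i) with hlt | hge
    · exact τ.C_mono i k (hg.trans hk) hlt
    · rw [τ.C_const i k hge, τ.C_const i (k + 1) (by omega)]

end TaskSet

theorem IsPattern.workload_le_maxWorkloadCI {T C R : ℕ} {rel : Set ℕ} {slots : ℕ → Finset ℕ}
    (hp : IsPattern T C R rel slots) (a Δ : ℕ) :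
    workload rel slots a Δ ≤ maxWorkloadCI T C R Δ := by
  refine le_csSup ⟨Δ, ?_⟩ ⟨rel, slots, a, hp, rfl⟩
  rintro w ⟨rel, slots, a, -, rfl⟩
  exact workload_le rel slots a Δ

theorem IsPattern.workload_le_maxWorkloadNC {T C R : ℕ} {rel : Set ℕ} {slots : ℕ → Finset ℕ}
    (hp : IsPattern T C R rel slots) {a Δ : ℕ} (hc : ¬ CarryIn rel slots a Δ) :
    workload rel slots a Δ ≤ maxWorkloadNC T C R Δ := by
  refine le_csSup ⟨Δ, ?_⟩ ⟨rel, slots, a, hp, hc, rfl⟩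
  rintro w ⟨rel, slots, a, -, -, rfl⟩
  exact workload_le rel slots a Δ

/-- Of a finite set with at least `m` elements, at least `m` have fewer than `m` predecessors. -/
theorem Finset.le_card_filter_card_lt {α : Type*} [LinearOrder α] (S : Finset α) (m : ℕ)
    (hm : m ≤ S.card) : m ≤ (S.filter fun j => (S.filter (· < j)).card < m).card := by
  induction S using Finset.induction_on_max with
  | empty => simpa using hm
  | insert a S ha ih =>
    have hnot : a ∉ S := fun h => lt_irrefl _ (ha a h)
    have key : ∀ j ∈ S, ((insert a S).filter (· < j)) = S.filter (· < j) := by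
      intro j hj
      rw [Finset.filter_insert, if_neg (not_lt.2 (ha j hj).le)]
    have hS : S.filter (fun j => (S.filter (· < j)).card < m) ⊆
        (insert a S).filter fun j => ((insert a S).filter (· < j)).card < m := by
      intro j hj
      rw [Finset.mem_filter] at hj ⊢
      exact ⟨Finset.mem_insert_of_mem hj.1, by rw [key j hj.1]; exact hj.2⟩
    rw [Finset.card_insert_of_notMem hnot] at hm
    -- Adding the maximum `a` changes no predecessor count in `S`. Either `S` is so small that every
    -- element qualifies, or `S` already supplies `m` of them.
    rcases Nat.lt_or_ge S.card m with hlt | hge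
    · have hall : (insert a S).filter (fun j => ((insert a S).filter (· < j)).card < m) =
          insert a S := by
        refine Finset.filter_true_of_mem fun j hj => ?_
        refine lt_of_le_of_lt (Finset.card_le_card ?_) hlt
        intro k hk
        rw [Finset.mem_filter, Finset.mem_insert] at hk
        rcases hk.1 with rfl | h
        · rcases Finset.mem_insert.1 hj with rfl | hj
          · exact absurd hk.2 (lt_irrefl _)
          · exact absurd hk.2 (not_lt.2 (ha j hj).le)
        · exact h
      rw [hall, Finset.card_insert_of_notMem hnot]
      exact hm
    · exact (ih hge).trans (Finset.card_le_card hS)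

/-! ### Execution, availability and contention -/

namespace Run

variable {n : ℕ} {X : Run n} {τ : TaskSet n} {i j : Fin n} {r s t m : ℕ}

theorem executed_mono (X : Run n) (i : Fin n) (r : ℕ) : Monotone (X.executed i r) :=
  fun _ _ h => by
    classical
    unfold executed
    exact Nat.count_monotone _ h

theorem executed_succ_of_runs (h : X.runs i r t) :
    X.executed i r (t + 1) = X.executed i r t + 1 := by
  classical
  unfold executed
  rw [Nat.count_succ, if_pos h]

theorem executed_succ_of_not_runs (h : ¬ X.runs i r t) :
    X.executed i r (t + 1) = X.executed i r t := by
  classical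
  unfold executed
  rw [Nat.count_succ, if_neg h, add_zero]

namespace Legal

theorem executed_le_cost (hX : X.Legal τ) (i : Fin n) (r t : ℕ) :
    X.executed i r t ≤ X.cost i r := by
  induction t with
  | zero => simp [executed]
  | succ t ih =>
    by_cases h : X.runs i r t
    · rw [executed_succ_of_runs h]
      exact (hX.runs_ok i r t h).2.2
    · rwa [executed_succ_of_not_runs h]

theorem executed_eq_zero (hX : X.Legal τ) (h : t ≤ r) : X.executed i r t = 0 := by
  induction t with
  | zero => simp [executed]
  | succ t ih =>
    rw [executed_succ_of_not_runs, ih (by omega)]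
    intro hr
    have := (hX.runs_ok i r t hr).2.1
    omega

end Legal

theorem InMode.of_le (h : X.InMode τ i r t) (hrs : r ≤ s) (hst : s ≤ t) : X.InMode τ i r s :=
  ⟨h.1, hrs, fun u h1 h2 => h.2.2 u h1 (h2.trans hst)⟩

theorem InMode.enabled (h : X.InMode τ i r t) : X.Enabled τ i t := h.2.2 t h.2.1 le_rfl

theorem Available.of_le (h : X.Available τ i r t) (hrs : r ≤ s) (hst : s ≤ t) :
    X.Available τ i r s :=
  ⟨h.1.of_le hrs hst, (X.executed_mono i r hst).trans_lt h.2⟩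

theorem InMode.available_of_runs (hX : X.Legal τ) (h : X.InMode τ i r t) (hr : X.runs i r t) :
    X.Available τ i r t :=
  ⟨h, (hX.runs_ok i r t hr).2.2⟩

theorem Available.exists_ready (h : X.Available τ i r t) : ∃ r', X.Ready τ i r' t := by
  classical
  have he : ∃ r, X.Available τ i r t := ⟨r, h⟩
  exact ⟨Nat.find he, Nat.find_spec he, fun r' h' => Nat.find_min he h'⟩

/-- A job of task `j` that has not been dropped executes in slot `t`. -/
def Executes (X : Run n) (τ : TaskSet n) (j : Fin n) (t : ℕ) : Prop :=
  ∃ r, X.InMode τ j r t ∧ X.runs j r t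

/-- At least `m` tasks of higher priority than `i` are ready in slot `t`. -/
def Contended (X : Run n) (τ : TaskSet n) (m : ℕ) (i : Fin n) (t : ℕ) : Prop :=
  m ≤ {j | j < i ∧ ∃ r, X.Ready τ j r t}.ncard

/-- The tasks of higher priority than `i` with an available job released before `a`. -/
def carryInTasks (X : Run n) (τ : TaskSet n) (i : Fin n) (a : ℕ) : Set (Fin n) :=
  {j | j < i ∧ ∃ r, r < a ∧ X.Available τ j r a}

open Classical in
/-- In a contended slot, at least `m` tasks of higher priority execute. -/
theorem Contended.le_card_executes (h : X.Contended τ m i t) (hs : X.ScheduledAt τ m t) :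
    m ≤ ((Finset.Iio i).filter fun j => X.Executes τ j t).card := by
  set S : Finset (Fin n) := (Finset.Iio i).filter fun j => ∃ r, X.Ready τ j r t with hS
  have hcard : {j | j < i ∧ ∃ r, X.Ready τ j r t}.ncard = S.card := by
    rw [← Set.ncard_coe_finset]
    congr 1
    ext j
    simp [hS]
  refine (S.le_card_filter_card_lt m (hcard ▸ h)).trans (Finset.card_le_card ?_)
  intro j hj
  rw [Finset.mem_filter] at hj
  obtain ⟨hjS, hlt⟩ := hj
  rw [hS, Finset.mem_filter] at hjS
  obtain ⟨hji, r, hr⟩ := hjS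
  rw [Finset.mem_filter]
  refine ⟨hji, r, hr.1.1, ((hs.1 j r hr.1.1).2 ⟨hr, ?_⟩)⟩
  refine lt_of_eq_of_lt ?_ hlt
  rw [← Set.ncard_coe_finset]
  congr 1
  ext k
  have : k < j → k < i := fun h => h.trans (Finset.mem_Iio.1 hji)
  simp [hS]
  tauto

/-- If slot `t` is not contended, then fewer than `m` tasks are carry-in at `t + 1`. -/
theorem ncard_carryInTasks_succ (h : ¬ X.Contended τ m i t) :
    (X.carryInTasks τ i (t + 1)).ncard < m := by
  refine lt_of_le_of_lt (Set.ncard_le_ncard ?_ (Set.toFinite _)) (not_le.1 h)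
  rintro j ⟨hj, r, hr, ha⟩
  exact ⟨hj, (ha.of_le (Nat.lt_succ_iff.1 hr) (Nat.le_succ t)).exists_ready⟩

/-! ### Settled runs: execution budgets, windows and workloads -/

/-- The run follows the protocol of the virtual level `v`, and from `b i` on the tasks of priority
at least that of `i` have no job left over from earlier. -/
structure Settled (X : Run n) (τ : TaskSet n) (m ℓ : ℕ) (v : ℕ → ℕ) (b : Fin n → ℕ) : Prop where
  mono : Monotone v
  le_level : ∀ t, ℓ ≤ v t
  sched : ∀ i t, b i ≤ t → X.ScheduledAt τ m t
  no_request : ∀ i t, b i ≤ t → ¬ X.IncreasingRequest τ (v t) t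
  enabled_iff : ∀ i t, b i ≤ t → (X.Enabled τ i t ↔ v t ≤ τ.L i)
  fresh : ∀ i j t r, j ≤ i → b i ≤ t → X.Available τ j r t → b j ≤ r
  carryIn : ∀ i, (X.carryInTasks τ i (b i)).ncard < m

namespace Settled

variable {ℓ g : ℕ} {v : ℕ → ℕ} {b : Fin n → ℕ}

theorem inMode (hS : X.Settled τ m ℓ v b) (hr : X.Released τ i r) (hb : b i ≤ r) (hrt : r ≤ t)
    (hv : v t ≤ τ.L i) : X.InMode τ i r t :=
  ⟨hr, hrt, fun s h1 h2 => (hS.enabled_iff i s (hb.trans h1)).2 ((hS.mono h2).trans hv)⟩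

theorem level_le (hS : X.Settled τ m ℓ v b) (hb : b i ≤ r) (h : X.InMode τ i r t) :
    v t ≤ τ.L i :=
  (hS.enabled_iff i t (hb.trans h.2.1)).1 h.enabled

/-- The virtual level bounds the execution time of the available jobs. -/
theorem executed_lt (hS : X.Settled τ m ℓ v b) (hℓ : 1 ≤ ℓ) (hX : X.Legal τ) (hb : b i ≤ r)
    (h : X.Available τ i r t) (hg : v t ≤ g) : X.executed i r t < τ.C i g := by
  have h1 : ∀ t, 1 ≤ v t := fun t => hℓ.trans (hS.le_level t)
  suffices H : X.executed i r t < τ.C i (v t) from H.trans_le (τ.C_le_C i (h1 t) hg)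
  have hrt := h.1.2.1
  induction t, hrt using Nat.le_induction generalizing g with
  | base => rw [hX.executed_eq_zero le_rfl]; exact τ.C_pos i _ (h1 r)
  | succ t hrt ih =>
    -- Below the task's own criticality, reaching the budget of the current level unfinished would
    -- trigger a forbidden request. At that criticality the cost itself is bounded.
    rcases (hS.level_le hb h.1).lt_or_eq with hlt | heq
    · have ha := h.of_le hrt (Nat.le_succ t)
      have hle := (ih ha le_rfl).trans_le (τ.C_le_C i (h1 t) (hS.mono (Nat.le_succ t)))
      by_cases hrun : X.runs i r t
      · refine lt_of_le_of_ne (by rw [executed_succ_of_runs hrun]; exact hle) fun he => ?_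
        exact hS.no_request i (t + 1) (by omega)
          ⟨t, i, r, rfl, hlt, ha.1, hrun, he, he ▸ h.2⟩
      · rwa [executed_succ_of_not_runs hrun]
    · rw [heq]
      exact h.2.trans_le (hX.cost_le i r h.1.1.1)

/-- Every job has a window that starts with fewer than `m` carry-in tasks and is contended up to
the release of the job. -/
theorem exists_window (hS : X.Settled τ m ℓ v b) (hb : b i ≤ r) :
    ∃ a, b i ≤ a ∧ a ≤ r ∧ (X.carryInTasks τ i a).ncard < m ∧
      ∀ t, a ≤ t → t < r → X.Contended τ m i t := by
  induction r, hb using Nat.le_induction with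
  | base => exact ⟨b i, le_rfl, le_rfl, hS.carryIn i, fun t h1 h2 => by omega⟩
  | succ r hr ih =>
    by_cases hc : X.Contended τ m i r
    · obtain ⟨a, h1, h2, h3, h4⟩ := ih
      refine ⟨a, h1, by omega, h3, fun t h5 h6 => ?_⟩
      rcases (Nat.lt_succ_iff.1 h6).lt_or_eq with h | rfl
      · exact h4 t h5 h
      · exact hc
    · exact ⟨r + 1, by omega, le_rfl, ncard_carryInTasks_succ hc, fun t h1 h2 => by omega⟩

open Classical in
/-- The slots of a window in which a task executes are the workload of a pattern. -/
theorem card_executes_le (hS : X.Settled τ m ℓ v b) (hℓ : 1 ≤ ℓ) (hX : X.Legal τ) {a Δ ρ : ℕ}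
    (hji : j < i) (ha : b i ≤ a) (hv : ∀ t, t < a + Δ → v t ≤ g)
    (hρ : ∀ r t, b j ≤ r → X.InMode τ j r t → X.runs j r t → v t ≤ g → t < r + ρ) :
    ((Finset.Ico a (a + Δ)).filter fun t => X.Executes τ j t).card ≤
        maxWorkloadCI (τ.T j) (τ.C j g) ρ Δ ∧
      (j ∉ X.carryInTasks τ i a →
        ((Finset.Ico a (a + Δ)).filter fun t => X.Executes τ j t).card ≤
          maxWorkloadNC (τ.T j) (τ.C j g) ρ Δ) := by
  -- Response bounds are only available for releases from `b j` on. Nothing is lost, since `fresh`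
  -- puts every job executing in the window among them.
  set rel : Set ℕ := {r | r ∈ X.act j ∧ b j ≤ r} with hrel
  set slots : ℕ → Finset ℕ := fun r =>
    (Finset.Ico a (a + Δ)).filter fun t => X.InMode τ j r t ∧ X.runs j r t with hslots
  have hmem : ∀ r t, t ∈ slots r ↔
      (a ≤ t ∧ t < a + Δ) ∧ X.InMode τ j r t ∧ X.runs j r t := by
    intro r t
    simp [hslots]
  have hp : IsPattern (τ.T j) (τ.C j g) ρ rel slots := by
    refine ⟨fun r hr r' hr' => hX.sporadic j r hr.1 r' hr'.1, fun r hr t ht => ?_, fun r hr => ?_⟩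
    · obtain ⟨⟨h1, h2⟩, h3, h4⟩ := (hmem r t).1 ht
      exact ⟨h3.2.1, hρ r t hr.2 h3 h4 (hv t h2)⟩
    · rw [← Finset.card_range (τ.C j g)]
      refine Finset.card_le_card_of_injOn (X.executed j r) (fun t ht => ?_) ?_
      · obtain ⟨⟨h1, h2⟩, h3, h4⟩ := (hmem r t).1 ht
        simpa using hS.executed_lt hℓ hX hr.2 (h3.available_of_runs hX h4) (hv t h2)
      · have hlt : ∀ t ∈ slots r, ∀ t', t < t' → X.executed j r t < X.executed j r t' := by
          intro t ht t' htt'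
          have h4 := ((hmem r t).1 ht).2.2
          refine lt_of_lt_of_le ?_ (X.executed_mono j r htt')
          rw [Nat.succ_eq_add_one, executed_succ_of_runs h4]
          exact Nat.lt_succ_self _
        intro t ht t' ht' he
        rcases lt_trichotomy t t' with h | h | h
        · exact absurd he (hlt t ht t' h).ne
        · exact h
        · exact absurd he (hlt t' ht' t h).ne'
  have hw : workload rel slots a Δ =
      ((Finset.Ico a (a + Δ)).filter fun t => X.Executes τ j t).card := by
    rw [← Set.ncard_coe_finset, workload]
    congr 1
    ext t
    simp only [Set.mem_ofPred_eq, Finset.mem_coe, Finset.mem_filter, Finset.mem_Ico]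
    constructor
    · rintro ⟨h1, h2, r, -, h3⟩
      exact ⟨⟨h1, h2⟩, r, ((hmem r t).1 h3).2⟩
    · rintro ⟨⟨h1, h2⟩, r, h3, h4⟩
      refine ⟨h1, h2, r, ⟨h3.1.1, ?_⟩, (hmem r t).2 ⟨⟨h1, h2⟩, h3, h4⟩⟩
      exact hS.fresh i j t r hji.le (ha.trans h1) (h3.available_of_runs hX h4)
  rw [← hw]
  refine ⟨hp.workload_le_maxWorkloadCI a Δ, fun hc => hp.workload_le_maxWorkloadNC ?_⟩
  rintro ⟨r, -, hra, t, ht, h1, -⟩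
  obtain ⟨-, h3, h4⟩ := (hmem r t).1 ht
  exact hc ⟨hji, r, hra, (h3.available_of_runs hX h4).of_le hra.le h1⟩

end Settled

end Run

/-! ### Validity of the computed response times -/

namespace Run

variable {n : ℕ} {X : Run n} {τ : TaskSet n} {R : Fin n → ℕ → ℕ} {i j : Fin n}
  {r s t m ℓ g : ℕ} {v : ℕ → ℕ} {b : Fin n → ℕ}

/-- The job of task `i` released at `r` completes within `R i g` of the start of its window, unless
the virtual level exceeds `g` before. -/
def Responds (X : Run n) (τ : TaskSet n) (m : ℕ) (R : Fin n → ℕ → ℕ) (v : ℕ → ℕ) (b : Fin n → ℕ)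
    (i : Fin n) (g r : ℕ) : Prop :=
  ∀ a, b i ≤ a → a ≤ r → (X.carryInTasks τ i a).ncard < m →
    (∀ t, a ≤ t → t < r → X.Contended τ m i t) → (∀ t, t < a + R i g → v t ≤ g) →
    (g < τ.L i → v (a + R i g) ≤ g) → X.executed i r (a + R i g) = X.cost i r

/-- The window starts no later than the release, so a bound measured from its start also holds from
the release; monotonicity of `v` supplies the level conditions. -/
theorem Responds.lt_add (h : X.Responds τ m R v b i g r) (hS : X.Settled τ m ℓ v b)
    (hb : b i ≤ r) (ha : X.Available τ i r t) (hv : v t ≤ g) : t < r + R i g := by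
  by_contra! hle
  obtain ⟨a, h1, h2, h3, h4⟩ := hS.exists_window hb
  have he := h a h1 h2 h3 h4 (fun s hs => (hS.mono (by omega)).trans hv)
    (fun _ => (hS.mono (by omega)).trans hv)
  have := X.executed_mono i r (show a + R i g ≤ t by omega)
  have := ha.2
  omega

namespace Settled

open Classical in
/-- Until its completion, a job that does not execute in a slot of its window leaves it to `m`
tasks of higher priority. -/
theorem le_card_executes (hS : X.Settled τ m ℓ v b) (hsched : τ.Schedulable R) {a : ℕ}
    (hℓ : 1 ≤ ℓ) (hg : ℓ ≤ g) (hgL : g ≤ τ.L i) (hr : X.Released τ i r) (hX : X.Legal τ)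
    (ihr : ∀ r', r' < r → b i ≤ r' → X.Released τ i r' → X.Responds τ m R v b i g r')
    (hba : b i ≤ a) (har : a ≤ r) (hcont : ∀ t, a ≤ t → t < r → X.Contended τ m i t)
    (hat : a ≤ t) (hv : v t ≤ g) (hex : X.executed i r t < X.cost i r) (hrun : ¬ X.runs i r t) :
    m ≤ ((Finset.Iio i).filter fun j => X.Executes τ j t).card := by
  refine Contended.le_card_executes ?_ (hS.sched i t (hba.trans hat))
  rcases lt_or_ge t r with hlt | hge
  · exact hcont t hat hlt
  have hin : X.InMode τ i r t := hS.inMode hr (hba.trans har) hge (hv.trans hgL)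
  by_contra hc
  -- In an uncontended slot only an earlier job of the same task could hold the job back, but that
  -- one is finished within `R ≤ D ≤ T` of its release.
  refine hrun (((hS.sched i t (hba.trans hat)).1 i r hin).2
    ⟨⟨⟨hin, hex⟩, fun r' hr' ha' => ?_⟩, not_le.1 hc⟩)
  have hb' := hS.fresh i i t r' le_rfl (hba.trans hat) ha'
  have h1 := (ihr r' hr' hb' ha'.1.1).lt_add hS hb' ha' hv
  have h2 := hX.sporadic i r' ha'.1.1.1 r hr.1 hr'
  have h3 := hsched i g (hℓ.trans hg) hgL
  have h4 := τ.D_le_T i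
  omega

open Classical in
-- The counting argument, with the three induction hypotheses: `ihj` confines the interfering jobs,
-- `ihg` truncates the windows of tasks of lower criticality, and `ihr` removes earlier jobs of the
-- same task.
theorem responds_step (hS : X.Settled τ m ℓ v b) (hm : 0 < m) (hR : τ.IsWCRT m R)
    (hsched : τ.Schedulable R) (hX : X.Legal τ) (hℓ : 1 ≤ ℓ) (hg : ℓ ≤ g) (hgL : g ≤ τ.L i)
    (hb : b i ≤ r) (hr : X.Released τ i r)
    (ihj : ∀ j, j < i → ∀ g, ℓ ≤ g → g ≤ τ.L j → ∀ r, b j ≤ r → X.Released τ j r →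
      X.Responds τ m R v b j g r)
    (ihg : ∀ g', g' < g → ℓ ≤ g' → X.Responds τ m R v b i g' r)
    (ihr : ∀ r', r' < r → b i ≤ r' → X.Released τ i r' → X.Responds τ m R v b i g r') :
    X.Responds τ m R v b i g r := by
  intro a hba har hcarry hcont hv hv'
  have hfix : R i g = τ.C i g + τ.totalInterf m R i (R i g) g / m :=
    (hR i g (hℓ.trans hg) hgL).1
  set x := R i g with hx
  have hCpos := τ.C_pos i g (hℓ.trans hg)
  by_contra hne
  have hinc : X.executed i r (a + x) < X.cost i r :=
    lt_of_le_of_ne (hX.executed_le_cost i r _) hne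
  have hincs : ∀ t, t ≤ a + x → X.executed i r t < X.cost i r := fun t ht =>
    (X.executed_mono i r ht).trans_lt hinc
  -- the job has received less than its budget
  have hexec : X.executed i r (a + x) < τ.C i g := by
    rcases le_or_gt (a + x) r with hle | hlt
    · rwa [hX.executed_eq_zero hle]
    -- The level at the endpoint `a + x` is needed only for `g < L i`, to exclude a request exactly
    -- there; for `g = L i` the cost bound suffices.
    · rcases hgL.lt_or_eq with hgL' | rfl
      · exact hS.executed_lt hℓ hX hb
          ⟨hS.inMode hr hb hlt.le ((hv' hgL').trans hgL), hinc⟩ (hv' hgL')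
      · exact hinc.trans_le (hX.cost_le i r hr.1)
  -- the slots in which it does not execute
  have hrunle : ((Finset.Ico a (a + x)).filter fun t => X.runs i r t).card ≤
      X.executed i r (a + x) := by
    unfold executed
    rw [Nat.count_eq_card_filter_range]
    refine Finset.card_le_card fun t ht => ?_
    simp only [Finset.mem_filter, Finset.mem_Ico, Finset.mem_range] at ht ⊢
    exact ⟨ht.1.2, ht.2⟩
  have hsplit := Finset.card_filter_add_card_filter_not
    (s := Finset.Ico a (a + x)) (fun t => X.runs i r t)
  rw [Nat.card_Ico] at hsplit
  -- Exactly as many slots are kept as the cap in `interfNC` and `interfCI`, so the cap holds for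
  -- every task's share.
  obtain ⟨B, hBsub, hBcard⟩ := Finset.exists_subset_card_eq
    (s := (Finset.Ico a (a + x)).filter fun t => ¬ X.runs i r t) (n := x + 1 - τ.C i g)
    (by omega)
  have hB : ∀ t ∈ B, (a ≤ t ∧ t < a + x) ∧ ¬ X.runs i r t := by
    intro t ht
    simpa using hBsub ht
  have hbusy : ∀ t ∈ B, m ≤ ((Finset.Iio i).filter fun j => X.Executes τ j t).card := by
    intro t ht
    obtain ⟨⟨h1, h2⟩, h3⟩ := hB t ht
    exact hS.le_card_executes hsched hℓ hg hgL hr hX ihr hba har hcont h1 (hv t h2)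
      (hincs t h2.le) h3
  -- the share of each task of higher priority
  have hshare : ∀ j ∈ Finset.Iio i, (B.filter fun t => X.Executes τ j t).card ≤
      τ.interfCI R j i x g ∧ (j ∉ X.carryInTasks τ i a →
        (B.filter fun t => X.Executes τ j t).card ≤ τ.interfNC R j i x g) := by
    intro j hj
    have hji := Finset.mem_Iio.1 hj
    have hresp : ∀ r t, b j ≤ r → X.InMode τ j r t → X.runs j r t → v t ≤ g →
        t < r + R j (min g (τ.L j)) := by
      intro r t hbj hin hrun hvt
      have hL := hS.level_le hbj hin
      have hlev := hS.le_level t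
      exact (ihj j hji _ (by omega) (min_le_right _ _) r hbj hin.1).lt_add hS hbj
        (hin.available_of_runs hX hrun) (le_min hvt hL)
    have hwin : τ.interfWindow R j i x g ≤ x := by
      unfold TaskSet.interfWindow
      split_ifs
      · exact min_le_left _ _
      · exact le_rfl
    have hsub : (B.filter fun t => X.Executes τ j t) ⊆
        (Finset.Ico a (a + τ.interfWindow R j i x g)).filter fun t => X.Executes τ j t := by
      intro t ht
      rw [Finset.mem_filter] at ht
      obtain ⟨htB, hE⟩ := ht
      obtain ⟨⟨h1, h2⟩, -⟩ := hB t htB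
      rw [Finset.mem_filter, Finset.mem_Ico]
      refine ⟨⟨h1, ?_⟩, hE⟩
      unfold TaskSet.interfWindow
      split_ifs with hLg
      -- If task `j` still executed here, the virtual level would not yet have exceeded `L j`, and
      -- `ihg` would have the job finished by `a + R i (L j)`.
      · by_contra! hle
        obtain ⟨r', hin, hrun⟩ := hE
        have hL := hS.level_le (hS.fresh i j t r' hji.le (hba.trans h1)
          (hin.available_of_runs hX hrun)) hin
        have hle' : a + R i (τ.L j) ≤ t := by omega
        have he := ihg (τ.L j) hLg ((hS.le_level t).trans hL) a hba har hcarry hcont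
          (fun s hs => (hS.mono (by omega)).trans hL) (fun _ => (hS.mono hle').trans hL)
        have := hincs (a + R i (τ.L j)) (by omega)
        omega
      · exact h2
    have hle := hS.card_executes_le hℓ hX (a := a) (Δ := τ.interfWindow R j i x g)
      hji hba (fun t ht => hv t (by omega)) hresp
    have hcB : (B.filter fun t => X.Executes τ j t).card ≤ x + 1 - τ.C i g :=
      hBcard ▸ Finset.card_filter_le _ _
    exact ⟨le_min ((Finset.card_le_card hsub).trans hle.1) hcB,
      fun hc => le_min ((Finset.card_le_card hsub).trans (hle.2 hc)) hcB⟩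
  -- the total interference
  set S : Finset (Fin n) := (Finset.Iio i).filter fun j => j ∈ X.carryInTasks τ i a with hSdef
  have hScard : S.card < m := by
    refine lt_of_eq_of_lt ?_ hcarry
    rw [← Set.ncard_coe_finset]
    congr 1
    ext j
    simp only [hSdef, Finset.mem_coe, Finset.mem_filter, Finset.mem_Iio, and_iff_right_iff_imp]
    exact fun h => h.1
  have hcount : m * (x + 1 - τ.C i g) ≤ τ.totalInterf m R i x g := by
    calc
      m * (x + 1 - τ.C i g) = ∑ t ∈ B, m := by
        rw [Finset.sum_const, hBcard, smul_eq_mul, mul_comm]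
      _ ≤ ∑ t ∈ B, ((Finset.Iio i).filter fun j => X.Executes τ j t).card :=
        Finset.sum_le_sum hbusy
      _ = ∑ j ∈ Finset.Iio i, (B.filter fun t => X.Executes τ j t).card :=
        Finset.sum_card_bipartiteAbove_eq_sum_card_bipartiteBelow (fun t j => X.Executes τ j t)
      _ ≤ ∑ j ∈ Finset.Iio i, (τ.interfNC R j i x g +
            if j ∈ X.carryInTasks τ i a then τ.interfDiff R j i x g else 0) := by
        refine Finset.sum_le_sum fun j hj => ?_
        obtain ⟨h1, h2⟩ := hshare j hj
        split_ifs with hc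
        · unfold TaskSet.interfDiff
          omega
        · exact h2 hc
      _ = ∑ j ∈ Finset.Iio i, τ.interfNC R j i x g + ∑ j ∈ S, τ.interfDiff R j i x g := by
        rw [Finset.sum_add_distrib, hSdef, Finset.sum_filter]
      _ ≤ τ.totalInterf m R i x g := by
        refine Nat.add_le_add_left (Finset.le_sup
          (f := fun S => ∑ j ∈ S, τ.interfDiff R j i x g) ?_) _
        rw [Finset.mem_filter, Finset.mem_powerset]
        exact ⟨Finset.filter_subset _ _, by omega⟩
  -- This yields `x + 1 - C i g ≤ totalInterf / m`, whereas the fixed point makes the right side `x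
  -- - C i g`.
  have := (Nat.le_div_iff_mul_le hm).2 ((mul_comm _ _).trans_le hcount)
  omega

/-- The computed response times are valid in a settled run. -/
theorem responds (hS : X.Settled τ m ℓ v b) (hm : 0 < m) (hR : τ.IsWCRT m R)
    (hsched : τ.Schedulable R) (hX : X.Legal τ) (hℓ : 1 ≤ ℓ) (i : Fin n) (g : ℕ) (hg : ℓ ≤ g)
    (hgL : g ≤ τ.L i) (r : ℕ) (hb : b i ≤ r) (hr : X.Released τ i r) :
    X.Responds τ m R v b i g r := by
  induction i using WellFoundedLT.induction generalizing g r with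
  | ind i ihj =>
  induction g using Nat.strong_induction_on generalizing r with
  | h g ihg =>
  induction r using Nat.strong_induction_on with
  | h r ihr =>
  exact hS.responds_step hm hR hsched hX hℓ hg hgL hb hr ihj
    (fun g' h1 h2 => ihg g' h1 h2 (h1.le.trans hgL) r hb hr) ihr

/-- A job meets its deadline if the virtual level does not exceed the criticality of its task. -/
theorem meetsDeadline (hS : X.Settled τ m ℓ v b) (hm : 0 < m) (hR : τ.IsWCRT m R)
    (hsched : τ.Schedulable R) (hX : X.Legal τ) (hℓ : 1 ≤ ℓ) (hb : b i ≤ r)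
    (hr : X.Released τ i r) (hv : ∀ t, r ≤ t → t < r + τ.D i → v t ≤ τ.L i) :
    X.MeetsDeadline τ i r := by
  have hD := τ.D_pos i
  have hv' : ∀ t, t < r + τ.D i → v t ≤ τ.L i := fun t ht =>
    (hS.mono (le_max_left t r)).trans (hv _ (le_max_right t r) (by omega))
  have hRD := hsched i (τ.L i) (τ.L_pos i) le_rfl
  obtain ⟨a, h1, h2, h3, h4⟩ := hS.exists_window hb
  have he := hS.responds hm hR hsched hX hℓ i (τ.L i)
    ((hS.le_level r).trans (hv' r (by omega))) le_rfl r hb hr a h1 h2 h3 h4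
    (fun t ht => hv' t (by omega)) (fun h => absurd h (lt_irrefl _))
  refine le_antisymm (hX.executed_le_cost i r _) ?_
  rw [← he]
  exact X.executed_mono i r (by omega)

end Settled

end Run

/-! ### The transition protocol produces a settled run -/

namespace Run

variable {n : ℕ} {X : Run n} {τ : TaskSet n} {R : Fin n → ℕ → ℕ} {i j : Fin n}
  {r t m h ℓ th tD : ℕ} {f : Fin n → ℕ} {last : Fin n}

/-- The time found for a task is the end of a slot that is not contended for the task, and no job
of the task released before that slot ends is available any more. -/
theorem Identifies.exists_slot (hf : X.Identifies τ R h ℓ tD f) (hsched : τ.Schedulable R)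
    (hX : X.Legal τ) (hℓ : 1 ≤ ℓ) (hℓh : ℓ < h) (htD : th < tD)
    (hdisp : ∀ t, th ≤ t → X.ScheduledAt τ m t)
    (hmode : ∀ t, th ≤ t → t < f i → X.InOperatingMode τ h t) (hi : h ≤ τ.L i) :
    ∃ s, f i = s + 1 ∧ ¬ X.Contended τ m i s ∧
      ∀ r t, f i ≤ t → X.Available τ i r t → f i ≤ r := by
  obtain ⟨⟨h1, -, r₀, ⟨s, hs, hrun, hcost⟩, hle⟩, -⟩ := hf i hi
  have hin := (hmode s (by omega) (by omega)).2 i r₀ hrun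
  obtain ⟨hready, hlt⟩ := ((hdisp s (by omega)).1 i r₀ hin).1 hrun
  refine ⟨s, hs, not_le.2 hlt, fun r t ht ha => ?_⟩
  by_contra! hr
  -- Jobs before `r₀` were gone when `r₀` was dispatched, and `r₀` itself completes at `f i`. Later
  -- ones come at least `T` after `r₀`, hence not before `f i ≤ r₀ + R i ℓ`.
  rcases lt_trichotomy r r₀ with hlt | rfl | hgt
  · exact hready.2 r hlt (ha.of_le (by omega) (by omega))
  · have := X.executed_mono i r ht
    have := ha.2
    omega
  · have h2 := hX.sporadic i r₀ hin.1.1 r ha.1.1.1 hgt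
    have h3 := hsched i ℓ hℓ (by omega)
    have h4 := τ.D_le_T i
    omega

/-- The level that the protocol prepares: `ℓ` up to time `u`, the level in force from then on. -/
def virtualLevel (X : Run n) (ℓ u t : ℕ) : ℕ := if t < u then ℓ else X.level t

open Classical in
/-- The time from which the response times of level `ℓ` are guaranteed for a task. -/
noncomputable def settlingTime (τ : TaskSet n) (h : ℕ) (f : Fin n → ℕ) (last i : Fin n) : ℕ :=
  if h ≤ τ.L i then f i else f last

theorem Identifies.mono (hf : X.Identifies τ R h ℓ tD f) (hj : h ≤ τ.L j) (hi : h ≤ τ.L i)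
    (hji : j ≤ i) : f j ≤ f i := by
  rcases hji.lt_or_eq with hlt | rfl
  · exact (hf i hi).1.2.1 j hlt hj
  · exact le_rfl

/-- Tasks that are suspended in mode `M_h` have no job left over from it. -/
theorem Available.le_of_suspended {u : ℕ} (ha : X.Available τ i r t) (hi : τ.L i < h) (hth : th < t)
    (hu : th < u) (hmode : ∀ t, th ≤ t → t < u → X.InOperatingMode τ h t) : u ≤ r := by
  by_contra! hr
  have hrt := ha.1.2.1
  -- This instant lies in the job's lifetime and in the interval of mode `M_h`, where the task is
  -- suspended.
  have hen : X.level (min t (u - 1)) ≤ τ.L i :=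
    ha.1.2.2 (min t (u - 1)) (by omega) (min_le_left _ _)
  have := (hmode (min t (u - 1)) (by omega) (by omega)).1
  omega

theorem ReenablesAt.virtualLevel_mono {u : ℕ} (hre : X.ReenablesAt τ ℓ u) :
    Monotone (X.virtualLevel ℓ u) := by
  refine monotone_nat_of_le_succ fun t => ?_
  unfold virtualLevel
  split_ifs with h1 h2 h2
  · exact le_rfl
  · obtain rfl : t + 1 = u := by omega
    exact hre.1.1.1
  · omega
  · exact (hre.2 t (by omega)).1.1

theorem ReenablesAt.le_virtualLevel {u : ℕ} (hre : X.ReenablesAt τ ℓ u) (t : ℕ) :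
    ℓ ≤ X.virtualLevel ℓ u t := by
  have h0 : X.virtualLevel ℓ u 0 ≤ X.virtualLevel ℓ u t := hre.virtualLevel_mono (Nat.zero_le t)
  refine le_trans ?_ h0
  unfold virtualLevel
  split_ifs with h
  · exact le_rfl
  · obtain rfl : u = 0 := by omega
    exact hre.1.1.1

theorem ReenablesAt.not_request {u : ℕ} (hre : X.ReenablesAt τ ℓ u) (hut : u ≤ t) :
    ¬ X.IncreasingRequest τ (X.level t) t := by
  rcases hut.lt_or_eq with h | rfl
  · obtain ⟨t, rfl⟩ : ∃ s, t = s + 1 := ⟨t - 1, by omega⟩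
    exact (hre.2 t (by omega)).1.2
  · exact hre.1.1.2

/-- As long as no increasing request is triggered, the level remains `ℓ`. -/
theorem ReenablesAt.level_le {u : ℕ} (hre : X.ReenablesAt τ ℓ u) (hut : u ≤ t)
    (hno : ∀ s, u ≤ s → s ≤ t → ¬ X.IncreasingRequest τ ℓ s) : X.level t ≤ ℓ := by
  induction t, hut using Nat.le_induction with
  | base => exact hre.1.2 ⟨le_rfl, hno u le_rfl le_rfl⟩
  | succ t ht ih =>
    exact (hre.2 t ht).2 ⟨ih fun s h1 h2 => hno s h1 (by omega), hno (t + 1) (by omega) le_rfl⟩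

theorem Identifies.settled (hf : X.Identifies τ R h ℓ tD f) (hsched : τ.Schedulable R)
    (hX : X.Legal τ) (hℓ : 1 ≤ ℓ) (hℓh : ℓ < h) (htD : th < tD)
    (hdisp : ∀ t, th ≤ t → X.ScheduledAt τ m t) (hlast : IsGreatest {i | h ≤ τ.L i} last)
    (hmode : ∀ t, th ≤ t → t < f last → X.InOperatingMode τ h t)
    (hno : ∀ t, tD ≤ t → t < f last → ¬ X.IncreasingRequest τ ℓ t)
    (hre : X.ReenablesAt τ ℓ (f last)) :
    X.Settled τ m ℓ (X.virtualLevel ℓ (f last)) (settlingTime τ h f last) := by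
  have hle_last : ∀ i, h ≤ τ.L i → f i ≤ f last := fun i hi => hf.mono hi hlast.1 (hlast.2 hi)
  have htD_le : ∀ i, h ≤ τ.L i → tD ≤ f i := fun i hi => (hf i hi).1.1
  have htD_last := htD_le last hlast.1
  have hb : ∀ i, tD ≤ settlingTime τ h f last i := by
    intro i
    unfold settlingTime
    split_ifs with hi
    · exact htD_le i hi
    · exact htD_last
  have hslot : ∀ i, h ≤ τ.L i → ∃ s, f i = s + 1 ∧ ¬ X.Contended τ m i s ∧
      ∀ r t, f i ≤ t → X.Available τ i r t → f i ≤ r := fun i hi =>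
    hf.exists_slot hsched hX hℓ hℓh htD hdisp
      (fun t h1 h2 => hmode t h1 (h2.trans_le (hle_last i hi))) hi
  refine ⟨hre.virtualLevel_mono, hre.le_virtualLevel, fun i t ht => hdisp t ?_, fun i t ht => ?_,
    fun i t ht => ?_, fun i j t r hji ht ha => ?_, fun i => ?_⟩
  · have := hb i
    omega
  · unfold virtualLevel
    split_ifs with hlt
    · exact hno t ((hb i).trans ht) hlt
    · exact hre.not_request (not_lt.1 hlt)
  · unfold virtualLevel Enabled
    split_ifs with hlt
    -- Before `f*` only tasks of `τ^h` have settled, so the virtual level `ℓ` and the actual level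
    -- `h` enable the same ones among them: all.
    · have hi : h ≤ τ.L i := by
        by_contra hi
        rw [settlingTime, if_neg hi] at ht
        omega
      rw [(hmode t (by have := hb i; omega) hlt).1]
      exact iff_of_true hi (by omega)
    · exact Iff.rfl
  · have hbi := hb i
    unfold settlingTime at ht ⊢
    split_ifs with hj
    · obtain ⟨s, -, -, hfr⟩ := hslot j hj
      refine hfr r t ?_ ha
      split_ifs at ht with hi
      · exact (hf.mono hj hi hji).trans ht
      · exact (hle_last j hj).trans ht
    · refine ha.le_of_suspended (not_le.1 hj) (th := th) ?_ (by omega) hmode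
      unfold settlingTime at hbi
      omega
  · unfold settlingTime
    split_ifs with hi
    · obtain ⟨s, hs, hc, -⟩ := hslot i hi
      rw [hs]
      exact ncard_carryInTasks_succ hc
    -- Whatever the priority of `i`, only tasks of `τ^h` can have old jobs at `f*`. All have
    -- priority at least that of `last`, and `last` has none left, so its uncontended slot bounds
    -- their number.
    · obtain ⟨s, hs, hc, hfr⟩ := hslot last hlast.1
      have hcard := ncard_carryInTasks_succ hc
      rw [← hs] at hcard
      refine lt_of_le_of_lt (Set.ncard_le_ncard ?_ (Set.toFinite _)) hcard
      rintro j ⟨-, r, hr, ha⟩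
      refine ⟨?_, r, hr, ha⟩
      have hj : h ≤ τ.L j := by
        by_contra hj
        have := ha.le_of_suspended (not_le.1 hj) (th := th) (by omega) (by omega) hmode
        omega
      refine lt_of_le_of_ne (hlast.2 hj) ?_
      rintro rfl
      have := hfr r _ le_rfl ha
      omega

end Run

/-- The system runs in mode `M_h` since time `th`, and a `DMCR_ℓ` is issued at time `tD`; what
happened before `th` is arbitrary. The task `last` is the last one of `τ^h` in priority order. -/
theorem mainTheorem2 {n : ℕ} (τ : TaskSet n) (m : ℕ) (hm : 0 < m)
    (R : Fin n → ℕ → ℕ) (hR : τ.IsWCRT m R) (hsched : τ.Schedulable R)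
    (h ℓ : ℕ) (hℓ : 1 ≤ ℓ) (hℓh : ℓ < h)
    (X : Run n) (hX : X.Legal τ)
    (th tD : ℕ) (htD : th < tD) (hdisp : ∀ t, th ≤ t → X.ScheduledAt τ m t)
    (f : Fin n → ℕ) (hf : X.Identifies τ R h ℓ tD f)
    (last : Fin n) (hlast : IsGreatest {i | h ≤ τ.L i} last)
    (hmode : ∀ t, th ≤ t → t < f last → X.InOperatingMode τ h t)
    (hno : ∀ t, tD ≤ t → t < f last → ¬ X.IncreasingRequest τ ℓ t)
    (hre : X.ReenablesAt τ ℓ (f last)) :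
    X.SafeReenabling τ h ℓ (f last) := by
  have hS := hf.settled hsched hX hℓ hℓh htD hdisp hlast hmode hno hre
  refine ⟨fun i _ t _ hl => ⟨hl, fun hact => ⟨hact, hl⟩⟩, fun i hi r hr hlev => ?_,
    fun i hℓi hih r hr hrel hreq => ?_⟩
  · obtain ⟨hrel, hb⟩ : X.Released τ i r ∧ Run.settlingTime τ h f last i ≤ r := by
      have hle : Run.settlingTime τ h f last i ≤ f last := by
        rw [Run.settlingTime, if_pos hi]
        exact hf.mono hi hlast.1 (hlast.2 hi)
      rcases hr with ha | ⟨hr, hrel⟩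
      · exact ⟨ha.1.1, hS.fresh i i _ r le_rfl hle ha⟩
      · exact ⟨hrel, hle.trans hr⟩
    refine hS.meetsDeadline hm hR hsched hX hℓ hb hrel fun t h1 h2 => ?_
    unfold Run.virtualLevel
    split_ifs
    · omega
    · exact hlev t h1 h2
  · have hb : Run.settlingTime τ h f last i ≤ r := by
      rwa [Run.settlingTime, if_neg (not_le.2 hih)]
    refine hS.meetsDeadline hm hR hsched hX hℓ hb hrel fun t h1 h2 => ?_
    unfold Run.virtualLevel
    split_ifs
    · exact hℓi
    · exact (hre.level_le (hr.trans h1) fun s h3 h4 => hreq s h3 (by omega)).trans hℓi
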